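/- Let $p$ be a prime, let $n\ge 1$, and let $\zeta=\zeta_{p^n}$ be a primitive $p^n$-th root of unity in a field of characteristic zero. Let $\mathbf Z_{(p)}\subset\mathbf Q$ be the localization of $\mathbf Z$ at the prime ideal $(p)$, and let $T=\mathbf Z_{(p)}[\zeta]$ and $t=1-\zeta$; then $T$ is a discrete valuation ring with maximal ideal generated by $t$. Let $C_{p^n}$ be the cyclic group of order $p^n$, with generator $c$. The localized cyclic Wedderburn embedding is the injective $T$-algebra homomorphism $$\omega_{p^n}:\; T\,C_{p^n}\;\longrightarrow\;\prod_{j\in\mathbf Z/p^n} T,\qquad c^i\longmapsto (\zeta^{ij})_{j\in\mathbf Z/p^n}\quad (0\le i\le p^n-1).$$ There are elements $d_0\mid d_1\mid\cdots\mid d_{p^n-1}$ of $T$ such that, with respect to suitable $T$-linear bases of source and target, $\omega_{p^n}$ is given by the diagonal matrix with entries $d_0,\dots,d_{p^n-1}$; for any such choice, $d_j$ is called the $(j+1)$-st elementary divisor of $\omega_{p^n}$. Let $j\in[0,p^n-1]$ and write $j=\sum_{k\ge 0}a_kp^k$ with $a_k\in[0,p-1]$. Then the $(j+1)$-st elementary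 divisor $d_j$ of $\omega_{p^n}$ has valuation $$v_t(d_j)\;=\;\sum_{k\ge 0}(a_k-a_{k+1})(k+1)p^k$$ at $t$ (for every choice of $d_0,\dots,d_{p^n-1}$ as above). -/

import Mathlib

/-- The ring `ℤ_(p)` of rational numbers `a / s` with `a, s ∈ ℤ` and `p ∤ s`: the localization of
`ℤ` at the complement of the prime ideal `(p)`, as a subring of `ℚ`. -/
noncomputable def localizedInt (p : ℕ) [hp : Fact p.Prime] : Subalgebra ℤ ℚ :=
  haveI : (Ideal.span {(p : ℤ)}).IsPrime :=
    (Ideal.span_singleton_prime (Int.natCast_ne_zero.mpr hp.out.ne_zero)).mpr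
      (Nat.prime_iff_prime_int.mp hp.out)
  Localization.subalgebra.ofField ℚ (Ideal.span {(p : ℤ)}).primeCompl
    (Ideal.primeCompl_le_nonZeroDivisors _)

theorem mem_localizedInt (p : ℕ) [Fact p.Prime] (x : ℚ) :
    x ∈ localizedInt p ↔ ∃ a s : ℤ, ¬ (p : ℤ) ∣ s ∧ x = a / s := by
  have h : x ∈ localizedInt p ↔ ∃ (a s : ℤ) (_ : s ∉ Ideal.span {(p : ℤ)}),
      x = algebraMap ℤ ℚ a * (algebraMap ℤ ℚ s)⁻¹ := Iff.rfl
  rw [h]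
  simp [Ideal.mem_span_singleton, div_eq_mul_inv]

/-- The ring `ℤ_(p)[ζ]`, for an element `ζ` of a field `K` of characteristic zero. -/
noncomputable abbrev localizedIntAdjoin (p : ℕ) [Fact p.Prime] {K : Type*} [Field K] [CharZero K]
    (ζ : K) : Subalgebra (localizedInt p) K :=
  Algebra.adjoin (localizedInt p) {ζ}

/-- The element `ζ` of `ℤ_(p)[ζ]`. -/
noncomputable def adjoinedElt (p : ℕ) [Fact p.Prime] {K : Type*} [Field K] [CharZero K]
    (ζ : K) : localizedIntAdjoin p ζ :=
  ⟨ζ, Algebra.self_mem_adjoin_singleton _ ζ⟩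

theorem adjoinedElt_pow_eq_one (p : ℕ) [Fact p.Prime] {K : Type*} [Field K] [CharZero K]
    {ζ : K} {m : ℕ} (h : ζ ^ m = 1) : adjoinedElt p ζ ^ m = 1 :=
  Subtype.ext h

/-- The `R`-algebra homomorphism `R C_m → ∏_{j ∈ ℤ/m} R`, `c_m ↦ (z ^ j)_j`, for `z ∈ R` with
`z ^ m = 1`. Here `C_m` is `ℤ/m` written multiplicatively, with generator `c_m` the class of `1`. -/
noncomputable def cyclicWedderburn {R : Type*} [CommRing R] (m : ℕ) [NeZero m] (z : R)
    (hz : z ^ m = 1) :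
    MonoidAlgebra R (Multiplicative (ZMod m)) →ₐ[R] (ZMod m → R) :=
  MonoidAlgebra.lift R (ZMod m → R) (Multiplicative (ZMod m))
    (MonoidHom.pi fun j => (AddChar.mulShift (AddChar.zmodChar m hz) j).toMonoidHom)

theorem cyclicWedderburn_apply {R : Type*} [CommRing R] (m : ℕ) [NeZero m] (z : R)
    (hz : z ^ m = 1) (i : ℕ) (j : ZMod m) :
    cyclicWedderburn m z hz
      (MonoidAlgebra.of R _ (Multiplicative.ofAdd (1 : ZMod m) ^ i)) j = z ^ (i * j.val) := by
  have h : cyclicWedderburn m z hz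
      (MonoidAlgebra.of R _ (Multiplicative.ofAdd (1 : ZMod m))) j = z ^ j.val := by
    rw [cyclicWedderburn, MonoidAlgebra.lift_of]
    change z ^ (j * 1).val = z ^ j.val
    rw [mul_one]
  rw [map_pow, map_pow, Pi.pow_apply, h, ← pow_mul, mul_comm]

/-- `d 0, d 1, …, d (m - 1)` are the elementary divisors (in this order, the first one being `d 0`)
of the `R`-linear map `f` between free modules of rank `m`: with respect to suitable bases, `f` is
given by the diagonal matrix with entries `d i`, and each entry divides all later ones. -/
def IsElementaryDivisors {R M N : Type*} [CommRing R] [AddCommGroup M] [Module R M]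
    [AddCommGroup N] [Module R N] (f : M →ₗ[R] N) {m : ℕ} (d : Fin m → R) : Prop :=
  (∀ i j : Fin m, i ≤ j → d i ∣ d j) ∧
    ∃ (b : Module.Basis (Fin m) R M) (c : Module.Basis (Fin m) R N), ∀ i, f (b i) = d i • c i

/-- The `k`-th digit of `j` in its expansion to the base `p` (zero beyond the last digit). -/
def baseDigit (p j k : ℕ) : ℕ := (Nat.digits p j).getD k 0

/-!
Write `q = ζ` for the `m`-th root of unity, `m = p ^ n`. The map sends a polynomial in the generator
`c` to its values at the nodes `1, q, …, q ^ (m - 1)`. In the Newton basis `∏_{i < k} (c - q ^ i)`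
of the source (`pow_mem_span_newton`), the `k`-th basis element has the value
`∏_{i < k} (q ^ j - q ^ i)` at `q ^ j`. It vanishes for `j < k`, and it is
`D k = ∏_{i < k} (q ^ (i + 1) - 1)` times a Gaussian binomial coefficient, up to units
(`prod_pow_sub_one_dvd`); for `j = k` that coefficient is `1`. Dividing by `D k` therefore leaves a
triangular matrix with units on the diagonal, that is, a basis of the target, and the `D k`, which
visibly divide one another, are elementary divisors (`isElementaryDivisors_cyclicWedderburn`). This
works over every domain that contains a primitive `m`-th root of unity.

The valuations at a prime `t` do not depend on the choice of the elementary divisors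
(`IsElementaryDivisors.emultiplicity_eq`), so it remains to find that of `D j`. Evaluation of
cyclotomic polynomials at `1` shows that `ζ ^ l - 1` has valuation `p ^ v_p(l)` for `0 < l < p ^ n`
(`emultiplicity_pow_sub_one`), and `∑_{l = 1}^{j} p ^ v_p(l)` is the sum over the digits of `j` by a
recursion that strips the last digit (`sum_padic_eq_sum_digits`).

Finally `ℤ_(p)[ζ]` is a discrete valuation ring with uniformizer `ζ - 1`
(`isDiscreteValuationRing_localizedIntAdjoin`): it is noetherian and integral over `ℤ_(p)`, so all
its maximal ideals contain `p`, hence also `ζ - 1`, of which a power is associated to `p`; and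
modulo `ζ - 1` every element comes from `ℤ_(p)`.
-/

/-! ### Sums of powers of `p` and digits to the base `p` -/

/-- Of the numbers `1, …, p * q + a`, the multiples of `p` are `p, 2 p, …, q p`, and each of the
`q * (p - 1) + a` others contributes `1`, while `p * l` contributes `p` times as much as `l`. -/
theorem sum_padic_mul_add (p : ℕ) [hp : Fact p.Prime] (q a : ℕ) (ha : a < p) :
    ∑ i ∈ Finset.range (p * q + a), p ^ padicValNat p (i + 1) =
      q * (p - 1) + a + p * ∑ i ∈ Finset.range q, p ^ padicValNat p (i + 1) := by
  have hp0 := hp.out.pos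
  have block (q a : ℕ) (ha : a < p) :
      ∑ i ∈ Finset.range a, p ^ padicValNat p (p * q + i + 1) = a := by
    rw [Finset.sum_congr rfl (g := fun _ => 1), Finset.sum_const, Finset.card_range, smul_eq_mul,
      mul_one]
    intro i hi
    have hi := Finset.mem_range.mp hi
    rw [padicValNat.eq_zero_of_not_dvd, pow_zero]
    rw [add_assoc, Nat.dvd_add_right (dvd_mul_right p q)]
    exact Nat.not_dvd_of_pos_of_lt (by omega) (by omega)
  rw [Finset.sum_range_add, block q a ha]
  suffices h : ∑ i ∈ Finset.range (p * q), p ^ padicValNat p (i + 1) =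
      q * (p - 1) + p * ∑ i ∈ Finset.range q, p ^ padicValNat p (i + 1) by
    rw [h]; ring
  induction q with
  | zero => simp
  | succ q ih =>
    have h1 : p * (q + 1) = p * q + ((p - 1) + 1) := by rw [Nat.sub_add_cancel hp0]; ring
    have h2 : p * q + (p - 1) + 1 = p * (q + 1) := by rw [h1]; ring
    rw [h1, Finset.sum_range_add, ih, Finset.sum_range_succ, block q _ (by omega), h2,
      padicValNat.mul hp.out.ne_zero (by omega), padicValNat_self, Finset.sum_range_succ]
    ring

theorem baseDigit_eq {p : ℕ} (hp : 2 ≤ p) (j k : ℕ) : baseDigit p j k = j / p ^ k % p :=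
  Nat.getD_digits j k hp

theorem baseDigit_mul_add_zero {p : ℕ} (hp : 2 ≤ p) (q : ℕ) {a : ℕ} (ha : a < p) :
    baseDigit p (p * q + a) 0 = a := by
  rw [baseDigit_eq hp, pow_zero, Nat.div_one, Nat.mul_add_mod, Nat.mod_eq_of_lt ha]

theorem baseDigit_mul_add_succ {p : ℕ} (hp : 2 ≤ p) (q : ℕ) {a : ℕ} (ha : a < p) (k : ℕ) :
    baseDigit p (p * q + a) (k + 1) = baseDigit p q k := by
  rw [baseDigit_eq hp, baseDigit_eq hp, pow_succ', ← Nat.div_div_eq_div_mul,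
    Nat.mul_add_div (by omega), Nat.div_eq_of_lt ha, add_zero]

theorem sum_baseDigit_mul_pow {p : ℕ} (hp : 2 ≤ p) (n j : ℕ) (hj : j < p ^ n) :
    ∑ k ∈ Finset.range n, baseDigit p j k * p ^ k = j := by
  induction n generalizing j with
  | zero => simp at hj; simp [hj]
  | succ n ih =>
    obtain ⟨q, a, ha, rfl⟩ : ∃ q a, a < p ∧ j = p * q + a :=
      ⟨j / p, j % p, Nat.mod_lt _ (by omega), (Nat.div_add_mod j p).symm⟩
    have hq : q < p ^ n := by
      rw [pow_succ'] at hj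
      exact Nat.lt_of_mul_lt_mul_left (a := p) (by omega)
    rw [Finset.sum_range_succ', baseDigit_mul_add_zero hp q ha]
    simp only [baseDigit_mul_add_succ hp q ha, pow_succ', mul_left_comm _ p]
    rw [← Finset.mul_sum, ih q hq]
    simp

/-- Both sides satisfy the same recursion under `j = p * q + a ↦ q`: on the right, the terms
`(a_k - a_{k+1}) p ^ (k + 1)` that the shift of the weight `k + 1` leaves over add up, by the
digit expansion, to `q * (p - 1) + a`. -/
theorem sum_padic_eq_sum_digits (p : ℕ) [hp : Fact p.Prime] (n j : ℕ) (hj : j < p ^ n) :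
    ((∑ i ∈ Finset.range j, p ^ padicValNat p (i + 1) : ℕ) : ℤ) =
      ∑ k ∈ Finset.range n,
        ((baseDigit p j k : ℤ) - baseDigit p j (k + 1)) * (k + 1) * (p : ℤ) ^ k := by
  have hp2 := hp.out.two_le
  induction n generalizing j with
  | zero => simp at hj; simp [hj]
  | succ n ih =>
    obtain ⟨q, a, ha, rfl⟩ : ∃ q a, a < p ∧ j = p * q + a :=
      ⟨j / p, j % p, Nat.mod_lt _ (by omega), (Nat.div_add_mod j p).symm⟩
    have hq : q < p ^ n := by
      rw [pow_succ'] at hj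
      exact Nat.lt_of_mul_lt_mul_left (a := p) (by omega)
    have e1 : (q : ℤ) = ∑ k ∈ Finset.range n, (baseDigit p q k : ℤ) * (p : ℤ) ^ k := by
      exact_mod_cast (sum_baseDigit_mul_pow hp2 n q hq).symm
    -- the digit of index `n` is zero here, so the expansion may run over `n + 1` digits
    have e2 : (q : ℤ) = ∑ k ∈ Finset.range n, (baseDigit p q (k + 1) : ℤ) * (p : ℤ) ^ (k + 1) +
        baseDigit p q 0 := by
      have h := sum_baseDigit_mul_pow hp2 (n + 1) q
        (hq.trans_le (Nat.pow_le_pow_right (by omega) (by omega)))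
      rw [Finset.sum_range_succ'] at h
      have h' := congrArg (Nat.cast (R := ℤ)) h
      push_cast at h'
      rw [← h']
      ring
    have e3 : ∑ k ∈ Finset.range n, ((baseDigit p q k : ℤ) - baseDigit p q (k + 1)) *
        (k + 1 + 1) * (p : ℤ) ^ (k + 1) =
        p * ∑ k ∈ Finset.range n, ((baseDigit p q k : ℤ) - baseDigit p q (k + 1)) *
          (k + 1) * (p : ℤ) ^ k +
        (p * ∑ k ∈ Finset.range n, (baseDigit p q k : ℤ) * (p : ℤ) ^ k -
          ∑ k ∈ Finset.range n, (baseDigit p q (k + 1) : ℤ) * (p : ℤ) ^ (k + 1)) := by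
      rw [Finset.mul_sum, Finset.mul_sum, ← Finset.sum_sub_distrib, ← Finset.sum_add_distrib]
      exact Finset.sum_congr rfl fun k _ => by ring
    rw [Finset.sum_range_succ', baseDigit_mul_add_succ hp2 q ha, baseDigit_mul_add_zero hp2 q ha]
    simp only [baseDigit_mul_add_succ hp2 q ha]
    push_cast
    rw [e3, ← ih q hq, ← e1, ← sub_eq_of_eq_add e2]
    have := congrArg (Nat.cast (R := ℤ)) (sum_padic_mul_add p q a ha)
    rw [Nat.cast_add, Nat.cast_add, Nat.cast_mul, Nat.cast_mul, Nat.cast_sub (by omega)] at this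
    push_cast at this ⊢
    rw [this]
    ring

/-! ### Elementary divisors -/

theorem IsElementaryDivisors.injective {R M N : Type*} [CommRing R] [IsDomain R] [AddCommGroup M]
    [Module R M] [AddCommGroup N] [Module R N] {f : M →ₗ[R] N} {m : ℕ} {d : Fin m → R}
    (h : IsElementaryDivisors f d) (hd : ∀ i, d i ≠ 0) : Function.Injective f := by
  obtain ⟨-, b, c, hf⟩ := h
  refine (injective_iff_map_eq_zero f).mpr fun x hx => b.ext_elem fun i => ?_
  rw [← b.sum_repr x, map_sum] at hx
  simp only [map_smul, hf, smul_smul] at hx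
  have := Fintype.linearIndependent_iff.mp c.linearIndependent _ hx i
  simpa [hd i] using this

/-- If `t ^ e` divided `d' j` but not `d j`, then the transition matrix between the two bases of
the source would, modulo `t`, have a zero block with rows `i ≤ j` and columns `i ≥ j`; this would
embed a free module of rank `m - j` over `R / t` into one of rank `m - j - 1`. -/
theorem IsElementaryDivisors.pow_dvd {R M N : Type*} [CommRing R] [IsDomain R] [AddCommGroup M]
    [Module R M] [AddCommGroup N] [Module R N] {f : M →ₗ[R] N} {m : ℕ} {d d' : Fin m → R}
    (h : IsElementaryDivisors f d) (h' : IsElementaryDivisors f d') {t : R} (ht : Prime t)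
    {j : Fin m} {e : ℕ} (hj : t ^ e ∣ d' j) : t ^ e ∣ d j := by
  obtain ⟨hdvd, b, c, hf⟩ := h
  obtain ⟨hdvd', b', c', hf'⟩ := h'
  by_contra hnot
  -- compare the `i`-th coordinates of `f (b' i')`, computed in both diagonal forms
  have key (i i' : Fin m) (hi : i ≤ j) (hi' : j ≤ i') : t ∣ b.repr (b' i') i := by
    have h1 : d i * b.repr (b' i') i = d' i' * c.repr (c' i') i := by
      have h2 : c.repr (f (b' i')) i = d' i' * c.repr (c' i') i := by simp [hf']
      rw [← h2]
      conv_rhs => rw [← b.sum_repr (b' i'), map_sum]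
      simp [hf, Finsupp.single_apply, mul_comm]
    by_contra hnt
    exact hnot ((ht.pow_dvd_of_dvd_mul_right e hnt
      (h1 ▸ dvd_mul_of_dvd_left (hj.trans (hdvd' _ _ hi')) _)).trans (hdvd _ _ hi))
  let Q := R ⧸ Ideal.span {t}
  let π : R →+* Q := Ideal.Quotient.mk _
  have hπ (x : R) : π x = 0 ↔ t ∣ x := by
    rw [Ideal.Quotient.eq_zero_iff_mem, Ideal.mem_span_singleton]
  have : Nontrivial Q := Ideal.Quotient.nontrivial_iff.mpr
    (by rw [Ne, Ideal.span_singleton_eq_top]; exact ht.not_isUnit)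
  let A : Matrix (Fin m) (Fin m) Q := (b.toMatrix b').map π
  let B : Matrix (Fin m) (Fin m) Q := (b'.toMatrix b).map π
  have hBA : B * A = 1 := by
    rw [← Matrix.map_mul, Module.Basis.toMatrix_mul_toMatrix_flip,
      Matrix.map_one _ π.map_zero π.map_one]
  let L : ({i // j ≤ i} → Q) →ₗ[Q] ({i // j < i} → Q) :=
    (A.submatrix (Subtype.val : {i // j < i} → _) (Subtype.val : {i // j ≤ i} → _)).mulVecLin
  have hL : Function.Injective L := by
    refine (injective_iff_map_eq_zero L).mpr fun x hx => ?_
    let y : Fin m → Q := fun i => if hi : j ≤ i then x ⟨i, hi⟩ else 0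
    have hy : A.mulVec y = 0 := by
      ext i
      have hsum : A.mulVec y i = ∑ i' : {i // j ≤ i}, A i i' * x i' := by
        rw [Matrix.mulVec, dotProduct, ← Finset.sum_subset (Finset.filter_subset (j ≤ ·) _)
          fun k _ hk => ?_, Finset.sum_subtype _ (p := (j ≤ ·)) (by simp)]
        · exact Finset.sum_congr rfl fun i' _ => by simp only [y, dif_pos i'.2]
        · have hk : ¬ j ≤ k := by simpa using hk
          simp only [y, dif_neg hk, mul_zero]
      rw [hsum]
      by_cases hi : j < i
      · exact congrFun hx ⟨i, hi⟩
      · refine Finset.sum_eq_zero fun i' _ => ?_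
        have : A i i' = 0 := (hπ _).mpr (key i i' (not_lt.mp hi) i'.2)
        rw [this, zero_mul]
    have hy0 : y = 0 := by
      rw [← Matrix.one_mulVec y, ← hBA, ← Matrix.mulVec_mulVec, hy, Matrix.mulVec_zero]
    ext i
    have := congrFun hy0 i
    simpa [y, i.2] using this
  have hcard := card_le_of_injective Q L hL
  rw [Fintype.card_subtype, Fintype.card_subtype] at hcard
  refine absurd hcard (not_le.mpr (Finset.card_lt_card ?_))
  refine (Finset.ssubset_iff_of_subset fun i hi => ?_).mpr ⟨j, by simp, by simp⟩
  simp only [Finset.mem_filter_univ] at hi ⊢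
  exact hi.le

theorem IsElementaryDivisors.emultiplicity_eq {R M N : Type*} [CommRing R] [IsDomain R]
    [AddCommGroup M] [Module R M] [AddCommGroup N] [Module R N] {f : M →ₗ[R] N} {m : ℕ}
    {d d' : Fin m → R} (h : IsElementaryDivisors f d) (h' : IsElementaryDivisors f d') {t : R}
    (ht : Prime t) (j : Fin m) : emultiplicity t (d j) = emultiplicity t (d' j) :=
  emultiplicity_eq_emultiplicity_iff.mpr fun _ => ⟨h'.pow_dvd h ht, h.pow_dvd h' ht⟩

/-! ### The Newton basis of the group ring of a cyclic group -/

/-- For `k ≤ n` the quotient is a Gaussian binomial coefficient times a power of `q`; the induction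
is the `q`-Pascal recursion. -/
theorem prod_pow_sub_one_dvd {R : Type*} [CommRing R] (q : R) (n k : ℕ) :
    ∏ i ∈ Finset.range k, (q ^ (i + 1) - 1) ∣ ∏ i ∈ Finset.range k, (q ^ n - q ^ i) := by
  induction n generalizing k with
  | zero =>
    cases k with
    | zero => simp
    | succ k =>
      rw [Finset.prod_range_succ' (fun i => q ^ 0 - q ^ i)]
      simp
  | succ n ih =>
    cases k with
    | zero => simp
    | succ k =>
      have h : ∏ i ∈ Finset.range (k + 1), (q ^ (n + 1) - q ^ i) =
          q ^ (k + 1) * ∏ i ∈ Finset.range (k + 1), (q ^ n - q ^ i) +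
            q ^ k * (∏ i ∈ Finset.range k, (q ^ n - q ^ i)) * (q ^ (k + 1) - 1) := by
        have h1 : ∏ i ∈ Finset.range k, (q ^ (n + 1) - q ^ (i + 1)) =
            q ^ k * ∏ i ∈ Finset.range k, (q ^ n - q ^ i) := by
          rw [Finset.prod_congr rfl (g := fun i => q * (q ^ n - q ^ i)) fun i _ => by ring,
            Finset.prod_mul_distrib, Finset.prod_const, Finset.card_range]
        rw [Finset.prod_range_succ', h1, Finset.prod_range_succ]
        ring
      rw [h]
      refine dvd_add (dvd_mul_of_dvd_right (ih (k + 1)) _) ?_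
      rw [Finset.prod_range_succ]
      exact mul_dvd_mul (dvd_mul_of_dvd_right (ih k) _) dvd_rfl

theorem associated_prod_pow_sub_pow {R : Type*} [CommRing R] {q : R} (hq : IsUnit q) (k : ℕ) :
    Associated (∏ i ∈ Finset.range k, (q ^ k - q ^ i))
      (∏ i ∈ Finset.range k, (q ^ (i + 1) - 1)) := by
  rw [← Finset.prod_range_reflect]
  refine Associated.prod _ _ _ fun i hi => ?_
  have hi := Finset.mem_range.mp hi
  have h : q ^ k - q ^ (k - 1 - i) = (q ^ (i + 1) - 1) * q ^ (k - 1 - i) := by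
    rw [sub_mul, ← pow_add, show i + 1 + (k - 1 - i) = k by omega, one_mul]
  rw [h]
  exact associated_mul_isUnit_left_iff (hq.pow _) |>.mpr (Associated.refl _)

/-- The powers of `x` expand in the Newton products `∏_{i < k} (x - a i)`, by the recursion
`x * g k = g (k + 1) + a k • g k`. -/
theorem pow_mem_span_newton {R A : Type*} [CommRing R] [CommRing A] [Algebra R A] (x : A)
    (a : ℕ → R) (l : ℕ) :
    x ^ l ∈ Submodule.span R
      ((fun k => ∏ i ∈ Finset.range k, (x - algebraMap R A (a i))) '' Set.Iic l) := by
  induction l with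
  | zero => exact Submodule.subset_span ⟨0, by simp, by simp⟩
  | succ l ih =>
    rw [pow_succ']
    refine (Submodule.span_le.mpr ?_ :
      _ ≤ (Submodule.span R _).comap (LinearMap.mulLeft R x)) ih
    rintro _ ⟨k, hk, rfl⟩
    have hk : k ≤ l := hk
    have h : x * ∏ i ∈ Finset.range k, (x - algebraMap R A (a i)) =
        ∏ i ∈ Finset.range (k + 1), (x - algebraMap R A (a i)) +
          a k • ∏ i ∈ Finset.range k, (x - algebraMap R A (a i)) := by
      rw [Finset.prod_range_succ, Algebra.smul_def]
      ring
    simp only [SetLike.mem_coe, Submodule.mem_comap, LinearMap.mulLeft_apply]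
    rw [h]
    exact add_mem (Submodule.subset_span ⟨k + 1, by simpa using hk, rfl⟩)
      (Submodule.smul_mem _ _ (Submodule.subset_span ⟨k, by simp; omega, rfl⟩))

/-- The matrix with entries `∏_{i < k} (q ^ j - q ^ i)` is triangular, and its `k`-th row is
divisible by `∏_{i < k} (q ^ (i + 1) - 1)`, which is up to a unit the diagonal entry. -/
theorem isElementaryDivisors_cyclicWedderburn {R : Type*} [CommRing R] [IsDomain R] {m : ℕ}
    [NeZero m] {q : R} (hq : IsPrimitiveRoot q m) :
    IsElementaryDivisors (cyclicWedderburn m q hq.pow_eq_one).toLinearMap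
      fun k : Fin m => ∏ i ∈ Finset.range k, (q ^ (i + 1) - 1) := by
  have hu : IsUnit q := hq.isUnit (NeZero.ne m)
  let D : ℕ → R := fun k => ∏ i ∈ Finset.range k, (q ^ (i + 1) - 1)
  have hD (k : Fin m) : D k ≠ 0 := by
    refine Finset.prod_ne_zero_iff.mpr fun i hi => sub_ne_zero.mpr ?_
    have hi := Finset.mem_range.mp hi
    exact hq.pow_ne_one_of_pos_of_lt (by omega) (by omega)
  have hdvd (n k : ℕ) : ∃ g, ∏ i ∈ Finset.range k, (q ^ n - q ^ i) = D k * g :=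
    prod_pow_sub_one_dvd q n k
  choose G hG using hdvd
  refine ⟨fun i j hij =>
    Finset.prod_dvd_prod_of_subset _ _ _ (Finset.range_subset_range.mpr hij), ?_⟩
  let e : Fin m ≃ ZMod m := (ZMod.finEquiv m).toEquiv
  have he (j : Fin m) : (e j).val = j := by
    obtain ⟨m, rfl⟩ := Nat.exists_eq_succ_of_ne_zero (NeZero.ne m)
    rfl
  -- the basis of the target
  let E : Module.Basis (Fin m) R (ZMod m → R) := (Pi.basisFun R (ZMod m)).reindex e.symm
  let c : Fin m → ZMod m → R := fun k j => G j.val k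
  have hE (j k : Fin m) : E.toMatrix c j k = G j k := by
    simp [E, c, Module.Basis.toMatrix_apply, he]
  have hc : LinearIndependent R c ∧ Submodule.span R (Set.range c) = ⊤ := by
    rw [E.is_basis_iff_det, Module.Basis.det_apply, Matrix.det_of_isLowerTriangular]
    · refine IsUnit.prod_univ_iff.mpr fun k => ?_
      rw [hE]
      have h := (associated_prod_pow_sub_pow hu k).symm
      rw [hG] at h
      obtain ⟨u, hu⟩ := h
      rw [← mul_left_cancel₀ (hD k) hu]
      exact u.isUnit
    · intro j k hjk
      have hjk : j < k := hjk
      have h := hG j k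
      rw [Finset.prod_eq_zero (Finset.mem_range.mpr hjk) (sub_self _)] at h
      rw [hE]
      exact (mul_eq_zero.mp h.symm).resolve_left (hD k)
  let C : Module.Basis (Fin m) R (ZMod m → R) := Module.Basis.mk hc.1 hc.2.ge
  -- the Newton basis of the source
  let x : MonoidAlgebra R (Multiplicative (ZMod m)) :=
    MonoidAlgebra.of R _ (Multiplicative.ofAdd (1 : ZMod m))
  let f := cyclicWedderburn m q hq.pow_eq_one
  let b : Fin m → MonoidAlgebra R (Multiplicative (ZMod m)) := fun k =>
    ∏ i ∈ Finset.range k, (x - algebraMap R _ (q ^ i))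
  have hx : f x = fun j => q ^ j.val := by
    ext j
    have h := cyclicWedderburn_apply m q hq.pow_eq_one 1 j
    rwa [pow_one, one_mul] at h
  have hf (k : Fin m) : f.toLinearMap (b k) = D k • C k := by
    ext j
    simp only [AlgHom.toLinearMap_apply, b, map_prod, map_sub, hx, AlgHom.commutes,
      Finset.prod_apply, Pi.sub_apply, Pi.algebraMap_apply, Algebra.algebraMap_self_apply,
      Pi.smul_apply, smul_eq_mul, C, Module.Basis.mk_apply, c]
    exact hG _ _
  -- independent because the images `D k • C k` are
  have hb : LinearIndependent R b := by
    refine LinearIndependent.of_comp f.toLinearMap (Fintype.linearIndependent_iff.mpr ?_)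
    intro g hg k
    simp only [Function.comp_apply, hf, smul_smul] at hg
    have hgk := Fintype.linearIndependent_iff.mp C.linearIndependent _ hg k
    exact (mul_eq_zero.mp hgk).resolve_right (hD k)
  have hspan : ⊤ ≤ Submodule.span R (Set.range b) := by
    intro y _
    refine MonoidAlgebra.induction_on y (fun g => ?_) (fun _ _ => add_mem)
      fun r _ => Submodule.smul_mem _ r
    have hg : MonoidAlgebra.of R _ g = x ^ (Multiplicative.toAdd g).val := by
      rw [← map_pow, ← ofAdd_nsmul]
      simp
    rw [hg]
    refine Submodule.span_mono ?_ (pow_mem_span_newton x (fun i => q ^ i) _)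
    rintro _ ⟨k, hk, rfl⟩
    exact ⟨⟨k, lt_of_le_of_lt hk (ZMod.val_lt _)⟩, rfl⟩
  exact ⟨Module.Basis.mk hb hspan, C, fun k => by rw [Module.Basis.mk_apply]; exact hf k⟩

/-! ### Primitive roots of unity of prime power order -/

theorem associated_sub_comm {R : Type*} [CommRing R] (a b : R) : Associated (a - b) (b - a) :=
  ⟨-1, by simp⟩

/-- Evaluate the cyclotomic polynomial `∏_μ (X - μ)` at `1`. -/
theorem associated_prime_sub_one_pow_totient {R : Type*} [CommRing R] [IsDomain R] {p k : ℕ}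
    [Fact p.Prime] {ζ : R} (hζ : IsPrimitiveRoot ζ (p ^ (k + 1))) :
    Associated (p : R) ((ζ - 1) ^ Nat.totient (p ^ (k + 1))) := by
  have h : (p : R) = ∏ μ ∈ primitiveRoots (p ^ (k + 1)) R, (1 - μ) := by
    rw [← Polynomial.eval_one_cyclotomic_prime_pow (R := R) (p := p) k,
      Polynomial.cyclotomic_eq_prod_X_sub_primitiveRoots hζ, Polynomial.eval_prod]
    simp
  rw [h, ← hζ.card_primitiveRoots, ← Finset.prod_const]
  refine Associated.prod _ _ _ fun μ hμ => ?_
  have hpos : 0 < p ^ (k + 1) := pow_pos (Fact.out : p.Prime).pos _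
  have : NeZero (p ^ (k + 1)) := ⟨hpos.ne'⟩
  obtain ⟨i, -, hi, rfl⟩ :=
    hζ.isPrimitiveRoot_iff.mp (isPrimitiveRoot_of_mem_primitiveRoots hμ)
  rw [← neg_sub]
  exact (hζ.associated_sub_one_pow_sub_one_of_coprime hi).symm.neg_left

/-- Write `l = p ^ s * u` with `u` prime to `p`. Then `ζ ^ l - 1` is associated to
`ζ ^ (p ^ s) - 1`, and both `ζ - 1` and `ζ ^ (p ^ s) - 1` have a power associated to `p`. -/
theorem emultiplicity_pow_sub_one {R : Type*} [CommRing R] [IsDomain R] {p n : ℕ}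
    [hp : Fact p.Prime] {ζ : R} (hζ : IsPrimitiveRoot ζ (p ^ n)) (ht : Prime (ζ - 1)) {l : ℕ}
    (hl0 : l ≠ 0) (hl : l < p ^ n) :
    emultiplicity (ζ - 1) (ζ ^ l - 1) = (p ^ padicValNat p l : ℕ) := by
  obtain ⟨s, u, hu, rfl⟩ := Nat.exists_eq_pow_mul_and_not_dvd hl0 p hp.out.ne_one
  have hu0 : u ≠ 0 := by rintro rfl; exact hu (dvd_zero p)
  have hs : s < n := (Nat.pow_lt_pow_iff_right hp.out.one_lt).mp
    ((Nat.le_mul_of_pos_right _ (Nat.pos_of_ne_zero hu0)).trans_lt hl)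
  obtain ⟨r, rfl⟩ : ∃ r, n = s + (r + 1) := ⟨n - s - 1, by omega⟩
  have hη : IsPrimitiveRoot (ζ ^ p ^ s) (p ^ (r + 1)) :=
    hζ.pow (pow_pos hp.out.pos _) (pow_add _ _ _)
  have h1 := associated_prime_sub_one_pow_totient hη
  have h2 := associated_prime_sub_one_pow_totient (k := s + r) hζ
  have h3 := hη.associated_sub_one_pow_sub_one_of_coprime (j := u)
    (Nat.Coprime.pow_right _ ((Nat.Prime.coprime_iff_not_dvd hp.out).mpr hu).symm)
  rw [← pow_mul] at h3
  have hval : padicValNat p (p ^ s * u) = s := by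
    rw [padicValNat.mul (pow_ne_zero _ hp.out.ne_zero) hu0, padicValNat.prime_pow,
      padicValNat.eq_zero_of_not_dvd hu, add_zero]
  rw [hval, ← emultiplicity_eq_of_associated_right h3]
  have h4 := emultiplicity_eq_of_associated_right (a := ζ - 1) (h1.symm.trans h2)
  rw [emultiplicity_pow ht, emultiplicity_pow_self ht.ne_zero ht.not_isUnit,
    Nat.totient_prime_pow_succ hp.out, Nat.totient_prime_pow_succ hp.out, pow_add] at h4
  have hp1 : p - 1 ≠ 0 := by have := hp.out.two_le; omega
  have hc : p ^ r * (p - 1) ≠ 0 := mul_ne_zero (pow_ne_zero _ hp.out.ne_zero) hp1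
  generalize emultiplicity (ζ - 1) (ζ ^ p ^ s - 1) = e at h4 ⊢
  cases e with
  | top =>
    rw [ENat.mul_top (by exact_mod_cast hc)] at h4
    exact absurd h4.symm (ENat.natCast_ne_top _)
  | coe e =>
    norm_cast at h4 ⊢
    refine Nat.eq_of_mul_eq_mul_left (Nat.pos_of_ne_zero hc) ?_
    rw [h4]
    ring

theorem emultiplicity_prod_pow_sub_one {R : Type*} [CommRing R] [IsDomain R] {p n : ℕ}
    [hp : Fact p.Prime] {ζ : R} (hζ : IsPrimitiveRoot ζ (p ^ n)) (ht : Prime (ζ - 1)) {j : ℕ}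
    (hj : j < p ^ n) :
    emultiplicity (ζ - 1) (∏ i ∈ Finset.range j, (ζ ^ (i + 1) - 1)) =
      (∑ i ∈ Finset.range j, p ^ padicValNat p (i + 1) : ℕ) := by
  rw [Finset.emultiplicity_prod ht, Nat.cast_sum]
  refine Finset.sum_congr rfl fun i hi => ?_
  have hi := Finset.mem_range.mp hi
  exact emultiplicity_pow_sub_one hζ ht (by omega) (by omega)

/-! ### The discrete valuation ring `ℤ_(p)[ζ]` -/

theorem localizedInt_isUnit_of_not_dvd (p : ℕ) [Fact p.Prime] (a : localizedInt p)
    (ha : ¬ (p : localizedInt p) ∣ a) : IsUnit a := by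
  have hp0 : ((p : ℤ) : ℚ) ≠ 0 := by exact_mod_cast (Fact.out : p.Prime).ne_zero
  obtain ⟨x, s, hs, hx⟩ := (mem_localizedInt p a).mp a.2
  have hs0 : (s : ℚ) ≠ 0 := by
    rintro h
    exact hs (by rw [Int.cast_eq_zero.mp h]; exact dvd_zero _)
  have hxp : ¬ (p : ℤ) ∣ x := by
    rintro ⟨y, rfl⟩
    refine ha ⟨⟨y / s, (mem_localizedInt p _).mpr ⟨y, s, hs, rfl⟩⟩, Subtype.ext ?_⟩
    rw [hx]
    push_cast
    ring
  have hx0 : (x : ℚ) ≠ 0 := by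
    rintro h
    exact hxp (by rw [Int.cast_eq_zero.mp h]; exact dvd_zero _)
  refine IsUnit.of_mul_eq_one ⟨s / x, (mem_localizedInt p _).mpr ⟨s, x, hxp, rfl⟩⟩
    (Subtype.ext ?_)
  change (a : ℚ) * (s / x) = 1
  rw [hx]
  field_simp

theorem localizedInt_not_isUnit (p : ℕ) [Fact p.Prime] : ¬ IsUnit (p : localizedInt p) := by
  intro h
  obtain ⟨b, hb⟩ := h.exists_right_inv
  obtain ⟨x, s, hs, hx⟩ := (mem_localizedInt p b).mp b.2
  have hs0 : (s : ℚ) ≠ 0 := by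
    rintro h
    exact hs (by rw [Int.cast_eq_zero.mp h]; exact dvd_zero _)
  have h1 : (p : ℚ) * (x / s) = 1 := by
    rw [← hx]
    exact congrArg Subtype.val hb
  refine hs ⟨x, ?_⟩
  field_simp at h1
  exact_mod_cast h1.symm

instance isNoetherianRing_localizedInt (p : ℕ) [hp : Fact p.Prime] :
    IsNoetherianRing (localizedInt p) := by
  have : (Ideal.span {(p : ℤ)}).IsPrime :=
    (Ideal.span_singleton_prime (Int.natCast_ne_zero.mpr hp.out.ne_zero)).mpr
      (Nat.prime_iff_prime_int.mp hp.out)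
  have : IsLocalization (Ideal.span {(p : ℤ)}).primeCompl (localizedInt p) :=
    Localization.subalgebra.isLocalization_ofField ℚ _ (Ideal.primeCompl_le_nonZeroDivisors _)
  exact IsLocalization.isNoetherianRing (Ideal.span {(p : ℤ)}).primeCompl _ inferInstance

section

variable {p n : ℕ} [Fact p.Prime] {K : Type*} [Field K] [CharZero K] {ζ : K}

theorem isPrimitiveRoot_adjoinedElt {m : ℕ} (hζ : IsPrimitiveRoot ζ m) :
    IsPrimitiveRoot (adjoinedElt p ζ) m :=
  IsPrimitiveRoot.of_map_of_injective (f := (localizedIntAdjoin p ζ).val) hζ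
    Subtype.val_injective

/-- A polynomial in `ζ` is congruent to its value at `1` modulo `ζ - 1`. -/
theorem exists_adjoinedElt_sub_one_dvd_sub (x : localizedIntAdjoin p ζ) :
    ∃ a : localizedInt p, adjoinedElt p ζ - 1 ∣ x - algebraMap _ _ a := by
  have hmem : (x : K) ∈ Algebra.adjoin (localizedInt p) {ζ} := x.2
  rw [Algebra.adjoin_singleton_eq_range_aeval] at hmem
  obtain ⟨f, hf⟩ := hmem
  have hx : x = Polynomial.aeval (adjoinedElt p ζ) f := by
    refine Subtype.ext ?_
    rw [← hf]
    exact (Polynomial.aeval_algHom_apply (localizedIntAdjoin p ζ).val (adjoinedElt p ζ) f)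
  refine ⟨f.eval 1, ?_⟩
  rw [hx, ← Polynomial.aeval_algebraMap_apply_eq_algebraMap_eval, map_one,
    ← Polynomial.eval_map_algebraMap, ← Polynomial.eval_map_algebraMap]
  exact Polynomial.sub_dvd_eval_sub _ _ _

theorem isIntegral_localizedIntAdjoin (hn : n ≠ 0) (hζ : ζ ^ n = 1) :
    Algebra.IsIntegral (localizedInt p) (localizedIntAdjoin p ζ) := by
  have hint : IsIntegral (localizedInt p) ζ :=
    IsIntegral.of_pow (Nat.pos_of_ne_zero hn) (hζ ▸ isIntegral_one)
  exact Algebra.IsIntegral.adjoin (by simpa using hint)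

theorem associated_prime_adjoinedElt_sub_one_pow {k : ℕ} (hζ : IsPrimitiveRoot ζ (p ^ (k + 1))) :
    Associated (p : localizedIntAdjoin p ζ)
      ((adjoinedElt p ζ - 1) ^ Nat.totient (p ^ (k + 1))) :=
  associated_prime_sub_one_pow_totient (isPrimitiveRoot_adjoinedElt hζ)

theorem adjoinedElt_sub_one_dvd_prime {k : ℕ} (hζ : IsPrimitiveRoot ζ (p ^ (k + 1))) :
    adjoinedElt p ζ - 1 ∣ (p : localizedIntAdjoin p ζ) :=
  (dvd_pow_self _ (Nat.totient_pos.mpr (pow_pos (Fact.out : p.Prime).pos _)).ne').trans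
    (associated_prime_adjoinedElt_sub_one_pow hζ).symm.dvd

/-- An integral extension reflects units, and `p` is not a unit of `ℤ_(p)`. -/
theorem not_isUnit_adjoinedElt_sub_one {k : ℕ} (hζ : IsPrimitiveRoot ζ (p ^ (k + 1))) :
    ¬ IsUnit (adjoinedElt p ζ - 1) := by
  intro h
  have := isIntegral_localizedIntAdjoin (p := p)
    (pow_ne_zero (k + 1) (Fact.out : p.Prime).ne_zero) hζ.pow_eq_one
  have hp := (associated_prime_adjoinedElt_sub_one_pow hζ).symm.isUnit (h.pow _)
  rw [← map_natCast (algebraMap (localizedInt p) (localizedIntAdjoin p ζ))] at hp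
  have hinj : Function.Injective (algebraMap (localizedInt p) (localizedIntAdjoin p ζ)) :=
    fun a b hab => Subtype.ext ((algebraMap ℚ K).injective (congrArg Subtype.val hab))
  have := (algebraMap_isIntegral_iff.mpr this).isLocalHom hinj
  exact localizedInt_not_isUnit p (isUnit_of_map_unit _ _ hp)

/-- A maximal ideal contains `p`, because it lies over the maximal ideal of `ℤ_(p)`, hence it
contains `ζ - 1`. Modulo `ζ - 1`, every element comes from `ℤ_(p)`. -/
theorem isUnit_of_not_adjoinedElt_sub_one_dvd {k : ℕ} (hζ : IsPrimitiveRoot ζ (p ^ (k + 1)))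
    {x : localizedIntAdjoin p ζ} (hx : ¬ adjoinedElt p ζ - 1 ∣ x) : IsUnit x := by
  have := isIntegral_localizedIntAdjoin (p := p)
    (pow_ne_zero (k + 1) (Fact.out : p.Prime).ne_zero) hζ.pow_eq_one
  by_contra hxu
  obtain ⟨M, hM, hxM⟩ := exists_max_ideal_of_mem_nonunits hxu
  let φ := algebraMap (localizedInt p) (localizedIntAdjoin p ζ)
  have hunit {a : localizedInt p} (ha : IsUnit a) : φ a ∉ M := fun h =>
    hM.ne_top (Ideal.eq_top_of_isUnit_mem _ h (ha.map φ))
  have hpM : (p : localizedIntAdjoin p ζ) ∈ M := by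
    have hmax : (M.comap φ).IsMaximal := Ideal.isMaximal_comap_of_isIntegral_of_isMaximal M
    by_contra hp
    have hp' : (p : localizedInt p) ∉ M.comap φ := by rwa [Ideal.mem_comap, map_natCast]
    obtain ⟨y, i, hi, hyi⟩ := hmax.exists_inv hp'
    refine hunit (localizedInt_isUnit_of_not_dvd p i fun hdvd => ?_) hi
    exact localizedInt_not_isUnit p (isUnit_of_dvd_one
      (hyi ▸ dvd_add (dvd_mul_left _ _) hdvd))
  have htM : adjoinedElt p ζ - 1 ∈ M := by
    refine hM.isPrime.mem_of_pow_mem (Nat.totient (p ^ (k + 1))) ?_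
    exact M.mem_of_dvd (associated_prime_adjoinedElt_sub_one_pow hζ).dvd hpM
  obtain ⟨a, ha⟩ := exists_adjoinedElt_sub_one_dvd_sub x
  refine hunit (a := a) (localizedInt_isUnit_of_not_dvd p a fun hdvd => hx ?_) ?_
  · have h := (adjoinedElt_sub_one_dvd_prime hζ).trans (map_natCast φ p ▸ map_dvd φ hdvd)
    exact (dvd_sub_left h).mp ha
  · have h := M.sub_mem hxM (M.mem_of_dvd ha htM)
    rwa [sub_sub_cancel] at h

theorem isDiscreteValuationRing_localizedIntAdjoin {k : ℕ}
    (hζ : IsPrimitiveRoot ζ (p ^ (k + 1))) :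
    IsDiscreteValuationRing (localizedIntAdjoin p ζ) ∧ Prime (adjoinedElt p ζ - 1) := by
  have hnu := not_isUnit_adjoinedElt_sub_one hζ
  have hloc : IsLocalRing (localizedIntAdjoin p ζ) := by
    refine IsLocalRing.of_isUnit_or_isUnit_one_sub_self fun a => ?_
    by_contra! h
    have h1 := not_imp_comm.mp (isUnit_of_not_adjoinedElt_sub_one_dvd hζ) h.1
    have h2 := not_imp_comm.mp (isUnit_of_not_adjoinedElt_sub_one_dvd hζ) h.2
    exact hnu (isUnit_of_dvd_one ((dvd_sub_left h1).mp h2))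
  have hmax : IsLocalRing.maximalIdeal (localizedIntAdjoin p ζ) =
      Ideal.span {adjoinedElt p ζ - 1} := by
    ext x
    rw [IsLocalRing.mem_maximalIdeal, mem_nonunits_iff, Ideal.mem_span_singleton]
    exact ⟨not_imp_comm.mp (isUnit_of_not_adjoinedElt_sub_one_dvd hζ),
      fun h hx => hnu (isUnit_of_dvd_unit h hx)⟩
  have ht0 : adjoinedElt p ζ - 1 ≠ 0 := by
    intro h
    have h1 := associated_prime_adjoinedElt_sub_one_pow hζ
    rw [h, zero_pow (Nat.totient_pos.mpr (pow_pos (Fact.out : p.Prime).pos _)).ne',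
      associated_zero_iff_eq_zero] at h1
    exact (Nat.cast_ne_zero.mpr (Fact.out : p.Prime).ne_zero) h1
  have : Algebra.FiniteType (localizedInt p) (localizedIntAdjoin p ζ) :=
    (Subalgebra.fg_iff_finiteType (localizedIntAdjoin p ζ)).mp
      (Subalgebra.fg_def.mpr ⟨{ζ}, Set.finite_singleton ζ, rfl⟩)
  have : IsNoetherianRing (localizedIntAdjoin p ζ) :=
    Algebra.FiniteType.isNoetherianRing (localizedInt p) _
  have hfield : ¬ IsField (localizedIntAdjoin p ζ) := by
    rw [IsLocalRing.isField_iff_maximalIdeal_eq, hmax, Ideal.span_singleton_eq_bot]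
    exact ht0
  have hprincipal : (IsLocalRing.maximalIdeal (localizedIntAdjoin p ζ)).IsPrincipal :=
    ⟨⟨_, hmax⟩⟩
  have hdvr : IsDiscreteValuationRing (localizedIntAdjoin p ζ) :=
    ((IsDiscreteValuationRing.TFAE _ hfield).out 0 4).mpr hprincipal
  refine ⟨hdvr, (Ideal.span_singleton_prime ht0).mp ?_⟩
  rw [← hmax]
  exact (IsLocalRing.maximalIdeal.isMaximal _).isPrime

end

theorem mainTheorem2 (p n : ℕ) [Fact p.Prime] (hn : 1 ≤ n) (K : Type*) [Field K] [CharZero K]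
    (ζ : K) (hζ : IsPrimitiveRoot ζ (p ^ n)) :
    -- `ℤ_(p)[ζ]` is a discrete valuation ring with uniformizer `t = 1 - ζ`
    IsDiscreteValuationRing (localizedIntAdjoin p ζ) ∧
    Irreducible (1 - adjoinedElt p ζ) ∧
    -- the map is an embedding and has elementary divisors
    Function.Injective
      (cyclicWedderburn (p ^ n) (adjoinedElt p ζ) (adjoinedElt_pow_eq_one p hζ.pow_eq_one)) ∧
    (∃ d : Fin (p ^ n) → localizedIntAdjoin p ζ, IsElementaryDivisors
      (cyclicWedderburn (p ^ n) (adjoinedElt p ζ)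
        (adjoinedElt_pow_eq_one p hζ.pow_eq_one)).toLinearMap d) ∧
    -- the valuations at `t` of the elementary divisors
    ∀ d : Fin (p ^ n) → localizedIntAdjoin p ζ, IsElementaryDivisors
      (cyclicWedderburn (p ^ n) (adjoinedElt p ζ)
        (adjoinedElt_pow_eq_one p hζ.pow_eq_one)).toLinearMap d →
      ∀ j : Fin (p ^ n), ∃ v : ℕ,
        emultiplicity (1 - adjoinedElt p ζ) (d j) = v ∧
        (v : ℤ) = ∑ k ∈ Finset.range n,
          ((baseDigit p j k : ℤ) - baseDigit p j (k + 1)) * (k + 1) * (p : ℤ) ^ k := by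
  obtain ⟨k, rfl⟩ := Nat.exists_eq_add_of_le' hn
  obtain ⟨hdvr, hprime⟩ := isDiscreteValuationRing_localizedIntAdjoin hζ
  have hassoc := associated_sub_comm (adjoinedElt p ζ) 1
  have hprime' := hassoc.prime hprime
  have hdiv := isElementaryDivisors_cyclicWedderburn (isPrimitiveRoot_adjoinedElt (p := p) hζ)
  have hval (j : Fin (p ^ (k + 1))) :=
    emultiplicity_prod_pow_sub_one (isPrimitiveRoot_adjoinedElt (p := p) hζ) hprime j.2
  refine ⟨hdvr, hprime'.irreducible, hdiv.injective fun i h => ?_, ⟨_, hdiv⟩, fun d hd j =>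
    ⟨∑ i ∈ Finset.range j, p ^ padicValNat p (i + 1), ?_, sum_padic_eq_sum_digits p _ j j.2⟩⟩
  · have := hval i
    rw [h, emultiplicity_zero] at this
    exact ENat.top_ne_natCast _ this
  · rw [hd.emultiplicity_eq hdiv hprime' j, emultiplicity_eq_of_associated_left hassoc, hval j]
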